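/- Let $p$ be a prime number. Say that $p$ is represented by $x^2+ny^2$ if there are integers $x,y$ with $p=x^2+ny^2$. (a) If $p\equiv 1\pmod{20}$, then $p$ is represented by both or by neither of the forms $x^2+20y^2$ and $x^2+100y^2$. (b) If $p\equiv 9\pmod{20}$, then $p$ is represented by exactly one of the forms $x^2+20y^2$ and $x^2+100y^2$. -/

import Mathlib

/-!
Both representations are governed by whether `5` is a quartic residue modulo `p`, that is, by the
quadratic character `χ` of a square root `c` of `5` in `ZMod p`.

* Write `p = x² + 5y²`. Then `x` is a square root of `-1` times `cy`, so `χ c` is found by computing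
  `χ x` and `χ y` with quadratic reciprocity. It is the quartic symbol `(p/5)₄` if `y` is even and
  its negative if `y` is odd.
* Write `p = a² + b²` with `b` odd, so that `t = a/b` is a square root of `-1`. Let `φ` be a root of
  `X² = X + 1`, so that `c = 2φ - 1` is a square root of `5`. Then `cφ = φ + 2`, and adjoining a
  square root of `-(φ + 2)` amounts to adjoining a fifth root of unity, so `χ (cφ) = (p/5)₄`. On the
  other hand `(φ + t)² = φ(1 + 2t)`, so `χ φ` is the Jacobi symbol of `b + 2a` modulo `5`. Comparing
  the two, `χ c = 1` if `5 ∣ a` and `χ c = -1` if `5 ∣ b`.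

Hence `x² + 100y²` represents `p` exactly if `χ c = 1`, and `x² + 20y²` exactly if
`χ c = (p/5)₄`, a symbol whose value is `1` for `p ≡ 1` and `-1` for `p ≡ 4` modulo `5`.
-/

open scoped NumberTheorySymbols

section FiniteField

variable {F : Type*} [Field F]

theorem isSquare_iff_exists_pow_four_eq_sq (h : IsSquare (-1 : F)) {c : F} :
    IsSquare c ↔ ∃ u : F, u ^ 4 = c ^ 2 := by
  constructor
  · rintro ⟨u, rfl⟩
    exact ⟨u, by ring⟩
  · rintro ⟨u, hu⟩
    rcases sq_eq_sq_iff_eq_or_eq_neg.mp (show c ^ 2 = (u ^ 2) ^ 2 by rw [← hu]; ring) with rfl | rfl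
    · exact IsSquare.sq u
    · exact neg_one_mul (u ^ 2) ▸ h.mul (IsSquare.sq u)

/-- With `ψ = φ - 1 = φ⁻¹`, the quadratic factor `X² - ψX + 1` of the fifth cyclotomic polynomial
has discriminant `-(φ + 2)`. -/
theorem exists_isPrimitiveRoot_five_of_isSquare (h2 : (2 : F) ≠ 0) (h5 : (5 : F) ≠ 0) {φ : F}
    (hφ : φ ^ 2 = φ + 1) (h : IsSquare (-(φ + 2))) : ∃ ζ : F, IsPrimitiveRoot ζ 5 := by
  obtain ⟨w, hw⟩ := h
  obtain ⟨ζ, hζ⟩ : ∃ ζ : F, 2 * ζ = φ - 1 + w := ⟨(φ - 1 + w) / 2, mul_div_cancel₀ _ h2⟩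
  have hquad : ζ ^ 2 - (φ - 1) * ζ + 1 = 0 := by
    refine (mul_eq_zero.mp ?_).resolve_left (mul_ne_zero h2 h2)
    linear_combination (2 * ζ - (φ - 1) + w) * hζ - hw - hφ
  have hcyclotomic : ζ ^ 4 + ζ ^ 3 + ζ ^ 2 + ζ + 1 = 0 := by
    linear_combination (ζ ^ 2 + φ * ζ + 1) * hquad + ζ ^ 2 * hφ
  have hpow : ζ ^ 5 = 1 := by linear_combination (ζ - 1) * hcyclotomic
  have hne : ζ ≠ 1 := by
    rintro rfl
    exact h5 (by linear_combination hcyclotomic)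
  have : Fact (Nat.Prime 5) := ⟨Nat.prime_five⟩
  exact ⟨ζ, IsPrimitiveRoot.iff_orderOf.mpr (orderOf_eq_prime hpow hne)⟩

theorem isSquare_neg_add_two_of_isPrimitiveRoot {φ ζ : F} (hφ : φ ^ 2 = φ + 1)
    (hζ : IsPrimitiveRoot ζ 5) : IsSquare (-(φ + 2)) := by
  have hpow : ζ ^ 5 = 1 := hζ.pow_eq_one
  have hcyclotomic : ζ ^ 4 + ζ ^ 3 + ζ ^ 2 + ζ + 1 = 0 := by
    refine (mul_eq_zero.mp ?_).resolve_left (sub_ne_zero.mpr (hζ.ne_one (by norm_num)))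
    linear_combination hpow
  have hroots : (φ - (ζ + ζ ^ 4 + 1)) * (φ + (ζ + ζ ^ 4)) = 0 := by
    linear_combination hφ - hcyclotomic - (ζ ^ 3 + 2) * hpow
  rcases mul_eq_zero.mp hroots with h | h
  · exact ⟨ζ - ζ ^ 4, by linear_combination -h - hcyclotomic + (2 - ζ ^ 3) * hpow⟩
  · exact ⟨ζ ^ 2 - ζ ^ 3, by linear_combination -h + (2 - ζ) * hpow⟩

variable [Fintype F]

theorem exists_isPrimitiveRoot_iff_dvd_card_sub_one {n : ℕ} [NeZero n] :
    (∃ ζ : F, IsPrimitiveRoot ζ n) ↔ n ∣ Fintype.card F - 1 := by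
  constructor
  · rintro ⟨ζ, hζ⟩
    exact hζ.dvd_of_pow_eq_one _
      (FiniteField.pow_card_sub_one_eq_one ζ (hζ.isUnit (NeZero.ne n)).ne_zero)
  · rintro ⟨m, hm⟩
    obtain ⟨g, hg⟩ := IsCyclic.exists_ofOrder_eq_natCard (α := Fˣ)
    rw [Nat.card_units, Nat.card_eq_fintype_card] at hg
    have hroot : IsPrimitiveRoot (g : F) (Fintype.card F - 1) :=
      IsPrimitiveRoot.coe_units_iff.mpr (hg ▸ IsPrimitiveRoot.orderOf g)
    exact ⟨g ^ m, hroot.pow (Nat.sub_pos_of_lt Fintype.one_lt_card) (by rw [hm, mul_comm])⟩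

variable [DecidableEq F]

theorem quadraticChar_eq_of_mul_eq_sq {u v w : F} (hw : w ≠ 0) (h : u * v = w ^ 2) :
    quadraticChar F u = quadraticChar F v := by
  refine Int.eq_of_mul_eq_one ?_
  rw [← map_mul, h, quadraticChar_sq_one' hw]

theorem quadraticChar_neg_of_sq_eq_neg_one {t : F} (ht : t ^ 2 = -1) (u : F) :
    quadraticChar F (-u) = quadraticChar F u := by
  have ht0 : t ≠ 0 := by rintro rfl; simp at ht
  rw [neg_eq_neg_one_mul, ← ht, map_mul, quadraticChar_sq_one' ht0, one_mul]

theorem quadraticChar_sqrt_neg_one (h2 : (2 : F) ≠ 0) {t : F} (ht : t ^ 2 = -1) :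
    quadraticChar F t = quadraticChar F 2 := by
  refine quadraticChar_eq_of_mul_eq_sq (w := 1 + t) (fun h => h2 ?_) (by linear_combination -ht)
  linear_combination ht + (1 - t) * h

theorem quadraticChar_eq_of_sq_add_mul_sq_eq_zero (h2 : (2 : F) ≠ 0) {t c x y : F}
    (ht : t ^ 2 = -1) (h : x ^ 2 + c ^ 2 * y ^ 2 = 0) :
    quadraticChar F x = quadraticChar F 2 * quadraticChar F c * quadraticChar F y := by
  have hsq : x ^ 2 = (t * c * y) ^ 2 := by linear_combination h - c ^ 2 * y ^ 2 * ht
  rw [← quadraticChar_sqrt_neg_one h2 ht, ← map_mul, ← map_mul]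
  rcases sq_eq_sq_iff_eq_or_eq_neg.mp hsq with rfl | rfl
  · rfl
  · exact quadraticChar_neg_of_sq_eq_neg_one ht _

theorem quadraticChar_goldenRatio (h5 : (5 : F) ≠ 0) {φ t : F} (hφ : φ ^ 2 = φ + 1)
    (ht : t ^ 2 = -1) : quadraticChar F φ = quadraticChar F (1 + 2 * t) := by
  refine quadraticChar_eq_of_mul_eq_sq (w := φ + t) (fun h => h5 ?_)
    (by linear_combination -hφ - ht)
  linear_combination (t + 3) * ht + (t + 2) * ((φ - t - 1) * h - hφ)

end FiniteField

section Arithmetic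

theorem sq_mod_five (n : ℕ) : n ^ 2 % 5 = 0 ∨ n ^ 2 % 5 = 1 ∨ n ^ 2 % 5 = 4 := by
  have hlt : n % 5 < 5 := Nat.mod_lt n (by norm_num)
  rw [Nat.pow_mod]
  interval_cases n % 5 <;> simp

theorem five_dvd_or_five_dvd_of_eq_sq_add_sq {n a b : ℕ} (hn : n % 5 = 1 ∨ n % 5 = 4)
    (h : n = a ^ 2 + b ^ 2) : 5 ∣ a ∨ 5 ∣ b := by
  have hsq : 5 ∣ a ^ 2 ∨ 5 ∣ b ^ 2 := by
    have ha := sq_mod_five a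
    have hb := sq_mod_five b
    omega
  exact hsq.imp Nat.prime_five.dvd_of_dvd_pow Nat.prime_five.dvd_of_dvd_pow

theorem sq_mod_eight_of_odd {n : ℕ} (hn : Odd n) : n ^ 2 % 8 = 1 := by
  have hdvd := Nat.eight_dvd_sq_sub_one_of_odd hn
  have hpos : 0 < n ^ 2 := pow_pos hn.pos 2
  omega

theorem even_and_even_of_four_mul_eq_sq_add_five_mul_sq {n x y : ℕ}
    (h : 4 * n = x ^ 2 + 5 * y ^ 2) : Even x ∧ Even y := by
  have hsq (z : ℕ) : Even z ∧ z ^ 2 % 2 = 0 ∨ Odd z ∧ z ^ 2 % 8 = 1 :=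
    (Nat.even_or_odd z).imp (fun hz => ⟨hz, Nat.even_iff.mp (hz.pow_of_ne_zero two_ne_zero)⟩)
      fun hz => ⟨hz, sq_mod_eight_of_odd hz⟩
  rcases hsq x with ⟨hx, hx'⟩ | ⟨-, hx'⟩ <;> rcases hsq y with ⟨hy, hy'⟩ | ⟨-, hy'⟩
  · exact ⟨hx, hy⟩
  all_goals omega

theorem odd_left_iff_even_right {n d x y : ℕ} (hn : Odd n) (hd : Odd d)
    (h : n = x ^ 2 + d * y ^ 2) : Odd x ↔ Even y := by
  rw [h, Nat.odd_add, Nat.even_mul, Nat.odd_pow_iff two_ne_zero, Nat.even_pow' two_ne_zero] at hn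
  simpa only [Nat.not_even_iff_odd.mpr hd, false_or] using hn

theorem odd_right_iff_even_left {n d x y : ℕ} (hn : Odd n) (hd : Odd d)
    (h : n = x ^ 2 + d * y ^ 2) : Odd y ↔ Even x := by
  rw [← Nat.not_even_iff_odd, ← odd_left_iff_even_right hn hd h, Nat.not_odd_iff_even]

theorem coprime_of_squarefree_eq_sq_add_mul_sq {n d x y : ℕ} (hn : Squarefree n)
    (h : n = x ^ 2 + d * y ^ 2) : x.Coprime y := by
  refine Nat.isUnit_iff.mp (hn _ ?_)
  rw [← pow_two, h]
  exact dvd_add (pow_dvd_pow_of_dvd (Nat.gcd_dvd_left x y) 2)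
    ((pow_dvd_pow_of_dvd (Nat.gcd_dvd_right x y) 2).mul_left d)

theorem exists_int_eq_sq_add_mul_sq_iff {n d : ℕ} :
    (∃ x y : ℤ, (n : ℤ) = x ^ 2 + d * y ^ 2) ↔ ∃ x y : ℕ, n = x ^ 2 + d * y ^ 2 := by
  constructor
  · rintro ⟨x, y, h⟩
    exact ⟨x.natAbs, y.natAbs, by zify; rw [sq_abs, sq_abs, h]⟩
  · rintro ⟨x, y, h⟩
    exact ⟨x, y, by exact_mod_cast h⟩

theorem exists_odd_dvd_map_eq_map_two_mul {M : Type*} [Monoid M] {f : ℕ → M}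
    (hf : ∀ a b, f (a * b) = f a * f b) {n : ℕ} (hn0 : n ≠ 0) (hn : Even n)
    (h4 : 4 ∣ n → f 2 = 1) : ∃ m, Odd m ∧ m ∣ n ∧ f n = f 2 * f m := by
  induction n using Nat.strong_induction_on with
  | _ n ih =>
    obtain ⟨k, rfl⟩ := hn.two_dvd
    rcases Nat.even_or_odd k with hk | hk
    · have hf2 : f 2 = 1 := h4 (mul_dvd_mul_left 2 hk.two_dvd)
      obtain ⟨m, hm, hmk, hfm⟩ := ih k (by omega) (by omega) hk fun _ => hf2
      exact ⟨m, hm, hmk.mul_left 2, by rw [hf, hfm, hf2, one_mul]⟩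
    · exact ⟨k, hk, dvd_mul_left k 2, hf 2 k⟩

/-- Thue's lemma. -/
theorem exists_sq_lt_and_dvd_mul_sub {n : ℕ} (hn : ¬IsSquare n) (s : ℤ) :
    ∃ x y : ℤ, 0 < y ∧ x ^ 2 < n ∧ y ^ 2 < n ∧ (n : ℤ) ∣ s * y - x := by
  have hn0 : 0 < n := Nat.pos_of_ne_zero fun h => hn (h ▸ IsSquare.zero)
  have hn0' : (0 : ℝ) < n := by exact_mod_cast hn0
  obtain ⟨j, k, hk0, hkn, hjk⟩ :=
    Real.exists_int_int_abs_mul_sub_le (s / n : ℝ) (Nat.sqrt_pos.mpr hn0)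
  refine ⟨s * k - n * j, k, hk0, ?_, ?_, ⟨j, by ring⟩⟩
  · have hle : |((s * k - n * j : ℤ) : ℝ)| ≤ n / (n.sqrt + 1) := by
      have hfactor : ((s * k - n * j : ℤ) : ℝ) = n * (k * (s / n) - j) := by
        push_cast
        field_simp
      rw [hfactor, abs_mul, abs_of_pos hn0', div_eq_mul_one_div (n : ℝ)]
      exact mul_le_mul_of_nonneg_left hjk hn0'.le
    have hlt : (n : ℝ) < (n.sqrt + 1) ^ 2 := by exact_mod_cast Nat.lt_succ_sqrt' n
    have hsq : ((s * k - n * j : ℤ) : ℝ) ^ 2 < n := by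
      calc ((s * k - n * j : ℤ) : ℝ) ^ 2 ≤ ((n : ℝ) / (n.sqrt + 1)) ^ 2 := by
            rw [← sq_abs]
            gcongr
        _ = (n : ℝ) * (n / (n.sqrt + 1) ^ 2) := by rw [div_pow, pow_two (n : ℝ), mul_div_assoc]
        _ < (n : ℝ) * 1 := mul_lt_mul_of_pos_left ((div_lt_one (by positivity)).mpr hlt) hn0'
        _ = (n : ℝ) := mul_one _
    exact_mod_cast hsq
  · have hle : k ^ 2 ≤ (n : ℤ) :=
      calc k ^ 2 ≤ (n.sqrt : ℤ) ^ 2 := by gcongr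
        _ ≤ (n : ℤ) := by exact_mod_cast Nat.sqrt_le' n
    refine hle.lt_of_ne fun h => hn (Int.isSquare_natCast_iff.mp ?_)
    exact h ▸ IsSquare.sq k

theorem exists_mul_eq_sq_add_mul_sq_of_dvd {n d : ℕ} (hn : ¬IsSquare n) (hd : 0 < d) {s : ℤ}
    (hs : (n : ℤ) ∣ s ^ 2 + d) : ∃ k x y : ℕ, 0 < k ∧ k ≤ d ∧ k * n = x ^ 2 + d * y ^ 2 := by
  obtain ⟨x, y, hy0, hx, hy, hxy⟩ := exists_sq_lt_and_dvd_mul_sub hn s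
  obtain ⟨k, hk⟩ : (n : ℤ) ∣ x ^ 2 + d * y ^ 2 := by
    have hident : x ^ 2 + d * y ^ 2 = y ^ 2 * (s ^ 2 + d) - (s * y - x) * (s * y + x) := by ring
    exact hident ▸ dvd_sub (hs.mul_left _) (hxy.mul_right _)
  have hdpos : (0 : ℤ) < d := by exact_mod_cast hd
  have hk0 : 0 < k := pos_of_mul_pos_right (hk ▸ by positivity) (Int.natCast_nonneg n)
  have hkd : k < d + 1 := by nlinarith [mul_lt_mul_of_pos_left hy hdpos]
  lift k to ℕ using hk0.le
  exact ⟨k, x.natAbs, y.natAbs, by exact_mod_cast hk0, by omega, by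
    zify; rw [sq_abs, sq_abs, hk, mul_comm]⟩

end Arithmetic

section JacobiSymbol

theorem jacobiSym_eq_of_mul_sq_modEq {a b u v : ℤ} {m : ℕ} (hu : IsCoprime u m)
    (hv : IsCoprime v m) (h : a * u ^ 2 ≡ b * v ^ 2 [ZMOD m]) : J(a | m) = J(b | m) := by
  have hJ := jacobiSym.mod_left' h
  rwa [jacobiSym.mul_left, jacobiSym.mul_left,
    jacobiSym.sq_one' (Int.isCoprime_iff_gcd_eq_one.mp hu),
    jacobiSym.sq_one' (Int.isCoprime_iff_gcd_eq_one.mp hv), mul_one, mul_one] at hJ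

/-- The rational quartic residue symbol `(n/5)₄` of a nonzero square `n` modulo `5`: the only
fourth power among the nonzero residues is `1`. The value is `-1` also where the symbol is not
defined. -/
def quarticSymbolFive (n : ℕ) : ℤ := if n % 5 = 1 then 1 else -1

theorem quarticSymbolFive_eq_one_iff {n : ℕ} : quarticSymbolFive n = 1 ↔ n % 5 = 1 := by
  unfold quarticSymbolFive
  split_ifs with h <;> simp [h]

theorem quarticSymbolFive_mul_self (n : ℕ) : quarticSymbolFive n * quarticSymbolFive n = 1 := by
  unfold quarticSymbolFive
  split_ifs <;> norm_num

theorem quarticSymbolFive_ne_zero (n : ℕ) : quarticSymbolFive n ≠ 0 := by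
  unfold quarticSymbolFive
  split_ifs <;> norm_num

theorem jacobiSym_five_eq_quarticSymbolFive {n : ℕ} (hn : n % 5 = 1 ∨ n % 5 = 4) {x : ℤ}
    (h : x ^ 2 ≡ n [ZMOD 5]) : J(x | 5) = quarticSymbolFive n := by
  have hx : (x % 5) ^ 2 % 5 = n % 5 := ((Int.mod_modEq x 5).pow 2).trans h
  have hx0 : 0 ≤ x % 5 := Int.emod_nonneg x (by norm_num)
  have hx5 : x % 5 < 5 := Int.emod_lt_of_pos x (by norm_num)
  rw [jacobiSym.mod_left, Nat.cast_ofNat, quarticSymbolFive]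
  interval_cases x % 5 <;> split_ifs with h1 <;> first | omega | norm_num

end JacobiSymbol

section ZModPrime

variable {p : ℕ} [Fact p.Prime]

theorem two_ne_zero_of_mod_four (hp4 : p % 4 = 1) : (2 : ZMod p) ≠ 0 := by
  exact_mod_cast ZMod.prime_ne_zero p 2 (by omega)

theorem five_ne_zero_of_mod_five (hp5 : p % 5 ≠ 0) : (5 : ZMod p) ≠ 0 := by
  have : Fact (Nat.Prime 5) := ⟨Nat.prime_five⟩
  exact_mod_cast ZMod.prime_ne_zero p 5 (by omega)

theorem exists_sq_eq_neg_one (hp4 : p % 4 = 1) : ∃ t : ZMod p, t ^ 2 = -1 := by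
  obtain ⟨t, ht⟩ := ZMod.exists_sq_eq_neg_one_iff.mpr (show p % 4 ≠ 3 by omega)
  exact ⟨t, by rw [ht, pow_two]⟩

theorem exists_sq_eq_five (hp5 : p % 5 = 1 ∨ p % 5 = 4) : ∃ c : ZMod p, c ^ 2 = 5 := by
  have : Fact (Nat.Prime 5) := ⟨Nat.prime_five⟩
  have hsq : IsSquare (p : ZMod 5) := by
    rw [← ZMod.natCast_mod]
    rcases hp5 with h | h <;> rw [h]
    exacts [⟨1, rfl⟩, ⟨2, rfl⟩]
  obtain ⟨c, hc⟩ :=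
    (ZMod.exists_sq_eq_prime_iff_of_mod_four_eq_one (p := 5) (by norm_num) (by omega)).mp hsq
  exact ⟨c, by rw [pow_two, ← hc, Nat.cast_ofNat]⟩

theorem quadraticChar_two_of_mod_four (hp4 : p % 4 = 1) :
    quadraticChar (ZMod p) 2 = if p % 8 = 1 then 1 else -1 := by
  have hp2 : p ≠ 2 := by omega
  rw [quadraticChar_two (by rwa [ZMod.ringChar_zmod_n]), ZMod.card, ZMod.χ₈_nat_eq_if_mod_eight]
  grind

theorem quadraticChar_natCast_eq_jacobiSym (hp4 : p % 4 = 1) {m : ℕ} (hm : Odd m) {d u v : ℤ}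
    (hu : IsCoprime u m) (hv : IsCoprime v m) (h : p * u ^ 2 ≡ d * v ^ 2 [ZMOD m]) :
    quadraticChar (ZMod p) m = J(d | m) :=
  calc quadraticChar (ZMod p) m = legendreSym p m := by rw [legendreSym, Int.cast_natCast]
    _ = J(m | p) := jacobiSym.legendreSym.to_jacobiSym p m
    _ = J(p | m) := jacobiSym.quadratic_reciprocity_one_mod_four' hm hp4
    _ = J(d | m) := jacobiSym_eq_of_mul_sq_modEq hu hv h

section SqAddMulSq

variable {d x y m : ℕ}

theorem isCoprime_of_eq_sq_add_mul_sq (h : p = x ^ 2 + d * y ^ 2) : IsCoprime (x : ℤ) y :=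
  Nat.isCoprime_iff_coprime.mpr
    (coprime_of_squarefree_eq_sq_add_mul_sq (Fact.out : p.Prime).prime.squarefree h)

theorem quadraticChar_eq_one_of_dvd_right (hp4 : p % 4 = 1) (h : p = x ^ 2 + d * y ^ 2)
    (hm : Odd m) (hmy : m ∣ y) : quadraticChar (ZMod p) m = 1 := by
  have hxm : IsCoprime (x : ℤ) m :=
    (isCoprime_of_eq_sq_add_mul_sq h).of_isCoprime_of_dvd_right (by exact_mod_cast hmy)
  rw [← jacobiSym.one_left m]
  refine quadraticChar_natCast_eq_jacobiSym hp4 hm isCoprime_one_left hxm ?_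
  obtain ⟨k, rfl⟩ := hmy
  refine (Int.modEq_iff_dvd.mpr ⟨d * m * k ^ 2, ?_⟩).symm
  rw [h]
  push_cast
  ring

theorem quadraticChar_eq_jacobiSym_of_dvd_left (hp4 : p % 4 = 1) (h : p = x ^ 2 + d * y ^ 2)
    (hm : Odd m) (hmx : m ∣ x) : quadraticChar (ZMod p) m = J(d | m) := by
  have hym : IsCoprime (y : ℤ) m :=
    (isCoprime_of_eq_sq_add_mul_sq h).symm.of_isCoprime_of_dvd_right (by exact_mod_cast hmx)
  refine quadraticChar_natCast_eq_jacobiSym hp4 hm isCoprime_one_left hym ?_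
  obtain ⟨k, rfl⟩ := hmx
  refine (Int.modEq_iff_dvd.mpr ⟨m * k ^ 2, ?_⟩).symm
  rw [h]
  push_cast
  ring

theorem natCast_sq_add_mul_sq_eq_zero (h : p = x ^ 2 + d * y ^ 2) :
    (x : ZMod p) ^ 2 + d * (y : ZMod p) ^ 2 = 0 := by
  rw [← ZMod.natCast_self p]
  exact_mod_cast congrArg (Nat.cast : ℕ → ZMod p) h.symm

end SqAddMulSq

theorem quadraticChar_sqrt_five_eq_one_iff (hp4 : p % 4 = 1) (hp5 : p % 5 ≠ 0) {c : ZMod p}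
    (hc : c ^ 2 = 5) : quadraticChar (ZMod p) c = 1 ↔ ∃ u : ZMod p, u ^ 4 = 5 := by
  have hc0 : c ≠ 0 := by
    rintro rfl
    exact five_ne_zero_of_mod_five hp5 (by rw [← hc, zero_pow two_ne_zero])
  have hneg : IsSquare (-1 : ZMod p) := ZMod.exists_sq_eq_neg_one_iff.mpr (by omega)
  rw [quadraticChar_one_iff_isSquare hc0, isSquare_iff_exists_pow_four_eq_sq hneg, hc]

section SumOfTwoSquares

theorem exists_eq_sq_add_sq_even_odd (hp4 : p % 4 = 1) :
    ∃ a b : ℕ, Even a ∧ Odd b ∧ p = a ^ 2 + b ^ 2 := by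
  obtain ⟨a, b, h⟩ := Nat.Prime.sq_add_sq (p := p) (by omega)
  have hodd : Odd p := Nat.odd_iff.mpr (by omega)
  have h' : p = a ^ 2 + 1 * b ^ 2 := by rw [one_mul, h]
  rcases Nat.even_or_odd b with hb | hb
  · exact ⟨b, a, hb, (odd_left_iff_even_right hodd odd_one h').mpr hb, by rw [← h, add_comm]⟩
  · exact ⟨a, b, (odd_right_iff_even_left hodd odd_one h').mp hb, hb, h.symm⟩

theorem quadraticChar_add_two_mul (hp4 : p % 4 = 1) {a b : ℕ} (h : p = a ^ 2 + b ^ 2)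
    (hb : Odd b) : quadraticChar (ZMod p) (b + 2 * a : ℕ) = J(b + 2 * a | 5) := by
  have hm : Odd (b + 2 * a) := hb.add_even (even_two_mul a)
  have h2 : IsCoprime ((2 : ℕ) : ℤ) (b + 2 * a : ℕ) :=
    Nat.isCoprime_iff_coprime.mpr (Nat.coprime_two_left.mpr hm)
  have hab : IsCoprime (a : ℤ) b :=
    isCoprime_of_eq_sq_add_mul_sq (p := p) (d := 1) (by rw [one_mul, h])
  have hbm : IsCoprime (b : ℤ) (b + 2 * a : ℕ) := by
    rw [Nat.isCoprime_iff_coprime, Nat.coprime_self_add_right]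
    exact (Nat.coprime_two_right.mpr hb).mul_right (Nat.isCoprime_iff_coprime.mp hab).symm
  have hmod : (p : ℤ) * (2 : ℕ) ^ 2 ≡ (5 : ℕ) * b ^ 2 [ZMOD (b + 2 * a : ℕ)] := by
    refine (Int.modEq_iff_dvd.mpr ⟨2 * a - b, ?_⟩).symm
    rw [h]
    push_cast
    ring
  rw [quadraticChar_natCast_eq_jacobiSym hp4 hm h2 hbm hmod,
    jacobiSym.quadratic_reciprocity_one_mod_four (by norm_num) hm]
  push_cast
  rfl

theorem quadraticChar_goldenRatio_eq_jacobiSym (hp4 : p % 4 = 1) (h5 : (5 : ZMod p) ≠ 0)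
    {φ : ZMod p} (hφ : φ ^ 2 = φ + 1) {a b : ℕ} (h : p = a ^ 2 + b ^ 2) (hb : Odd b) :
    quadraticChar (ZMod p) φ = J(b + 2 * a | 5) := by
  have h' : p = a ^ 2 + 1 * b ^ 2 := by rw [one_mul, h]
  have hχb : quadraticChar (ZMod p) b = 1 := quadraticChar_eq_one_of_dvd_right hp4 h' hb dvd_rfl
  have hb0 : (b : ZMod p) ≠ 0 := by
    intro hb0
    simp [hb0] at hχb
  have hzero := natCast_sq_add_mul_sq_eq_zero h'
  have ht : (a / b : ZMod p) ^ 2 = -1 := by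
    field_simp
    linear_combination hzero
  rw [← quadraticChar_add_two_mul hp4 h hb, quadraticChar_goldenRatio h5 hφ ht,
    ← one_mul (quadraticChar (ZMod p) (1 + _)), ← hχb, ← map_mul]
  congr 1
  push_cast
  field_simp

theorem quadraticChar_goldenRatio_add_two (hp4 : p % 4 = 1) (hp5 : p % 5 ≠ 0) {φ : ZMod p}
    (hφ : φ ^ 2 = φ + 1) : quadraticChar (ZMod p) (φ + 2) = quarticSymbolFive p := by
  have h2 := two_ne_zero_of_mod_four hp4
  have h5 := five_ne_zero_of_mod_five hp5
  have hroot : IsSquare (-(φ + 2)) ↔ p % 5 = 1 :=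
    calc IsSquare (-(φ + 2)) ↔ ∃ ζ : ZMod p, IsPrimitiveRoot ζ 5 :=
          ⟨exists_isPrimitiveRoot_five_of_isSquare h2 h5 hφ,
            fun ⟨_, hζ⟩ => isSquare_neg_add_two_of_isPrimitiveRoot hφ hζ⟩
      _ ↔ 5 ∣ p - 1 := by rw [exists_isPrimitiveRoot_iff_dvd_card_sub_one, ZMod.card]
      _ ↔ p % 5 = 1 := by have := (Fact.out : p.Prime).pos; omega
  have hne : -(φ + 2) ≠ 0 := fun h => h5 (by linear_combination hφ + (φ - 3) * h)
  obtain ⟨t, ht⟩ := exists_sq_eq_neg_one hp4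
  rw [← quadraticChar_neg_of_sq_eq_neg_one ht, quarticSymbolFive]
  split_ifs with h
  · rwa [quadraticChar_one_iff_isSquare hne, hroot]
  · rwa [quadraticChar_neg_one_iff_not_isSquare, hroot]

/-- Burde's rational quartic reciprocity law for the primes `5` and `p`. -/
theorem quadraticChar_sqrt_five_mul_jacobiSym (hp4 : p % 4 = 1) (hp5 : p % 5 ≠ 0) {c : ZMod p}
    (hc : c ^ 2 = 5) {a b : ℕ} (h : p = a ^ 2 + b ^ 2) (hb : Odd b) :
    quadraticChar (ZMod p) c * J(b + 2 * a | 5) = quarticSymbolFive p := by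
  have h2 := two_ne_zero_of_mod_four hp4
  obtain ⟨φ, hφc⟩ : ∃ φ : ZMod p, 2 * φ = c + 1 := ⟨(c + 1) / 2, mul_div_cancel₀ _ h2⟩
  have hφ : φ ^ 2 = φ + 1 := by
    refine sub_eq_zero.mp ((mul_eq_zero.mp ?_).resolve_left (mul_ne_zero h2 h2))
    linear_combination (2 * φ + c - 1) * hφc + hc
  have hcφ : c * φ = φ + 2 := by linear_combination -φ * hφc + 2 * hφ
  rw [← quadraticChar_goldenRatio_eq_jacobiSym hp4 (five_ne_zero_of_mod_five hp5) hφ h hb,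
    ← map_mul, hcφ, quadraticChar_goldenRatio_add_two hp4 hp5 hφ]

theorem quadraticChar_sqrt_five_eq_one_of_dvd (hp4 : p % 4 = 1) (hp5 : p % 5 = 1 ∨ p % 5 = 4)
    {c : ZMod p} (hc : c ^ 2 = 5) {a b : ℕ} (h : p = a ^ 2 + b ^ 2) (hb : Odd b) (ha : 5 ∣ a) :
    quadraticChar (ZMod p) c = 1 := by
  have hburde := quadraticChar_sqrt_five_mul_jacobiSym hp4 (by omega) hc h hb
  obtain ⟨k, rfl⟩ := ha
  have hmod : ((b : ℤ) + 2 * (5 * k : ℕ)) ^ 2 ≡ p [ZMOD 5] := by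
    refine (Int.modEq_iff_dvd.mpr ⟨4 * b * k + 15 * k ^ 2, ?_⟩).symm
    rw [h]
    push_cast
    ring
  rw [jacobiSym_five_eq_quarticSymbolFive hp5 hmod] at hburde
  exact (mul_eq_right₀ (quarticSymbolFive_ne_zero p)).mp hburde

theorem quadraticChar_sqrt_five_eq_neg_one_of_dvd (hp4 : p % 4 = 1)
    (hp5 : p % 5 = 1 ∨ p % 5 = 4) {c : ZMod p} (hc : c ^ 2 = 5) {a b : ℕ}
    (h : p = a ^ 2 + b ^ 2) (hb : Odd b) (hb5 : 5 ∣ b) : quadraticChar (ZMod p) c = -1 := by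
  have hburde := quadraticChar_sqrt_five_mul_jacobiSym hp4 (by omega) hc h hb
  obtain ⟨k, rfl⟩ := hb5
  have hmod : (a : ℤ) ^ 2 ≡ p [ZMOD 5] := by
    refine Int.modEq_iff_dvd.mpr ⟨5 * k ^ 2, ?_⟩
    rw [h]
    push_cast
    ring
  have hJ : J((5 * k : ℕ) + 2 * a | 5) = -quarticSymbolFive p :=
    calc J((5 * k : ℕ) + 2 * a | 5) = J(2 * a | 5) :=
          jacobiSym.mod_left' (by push_cast; exact Int.mul_add_emod_self_left 5 k (2 * a))
      _ = J(2 | 5) * J(a | 5) := jacobiSym.mul_left 2 a 5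
      _ = -quarticSymbolFive p := by
          rw [jacobiSym_five_eq_quarticSymbolFive hp5 hmod]
          norm_num
  rw [hJ, mul_neg, ← neg_mul] at hburde
  exact neg_eq_iff_eq_neg.mp ((mul_eq_right₀ (quarticSymbolFive_ne_zero p)).mp hburde)

theorem exists_eq_sq_add_hundred_mul_sq_iff (hp4 : p % 4 = 1) (hp5 : p % 5 = 1 ∨ p % 5 = 4) :
    (∃ x y : ℕ, p = x ^ 2 + 100 * y ^ 2) ↔ ∃ u : ZMod p, u ^ 4 = 5 := by
  obtain ⟨c, hc⟩ := exists_sq_eq_five hp5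
  rw [← quadraticChar_sqrt_five_eq_one_iff hp4 (by omega) hc]
  constructor
  · rintro ⟨x, y, h⟩
    have h' : p = (5 * (2 * y)) ^ 2 + x ^ 2 := by rw [h]; ring
    have hx : Odd x := by
      refine (Nat.odd_pow_iff two_ne_zero).mp (Nat.odd_iff.mpr ?_)
      omega
    exact quadraticChar_sqrt_five_eq_one_of_dvd hp4 hp5 hc h' hx (dvd_mul_right 5 _)
  · intro hχ
    obtain ⟨a, b, ha, hb, h⟩ := exists_eq_sq_add_sq_even_odd hp4
    rcases five_dvd_or_five_dvd_of_eq_sq_add_sq hp5 h with ha5 | hb5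
    · obtain ⟨k, rfl⟩ : 10 ∣ a := by
        have := ha.two_dvd
        omega
      exact ⟨b, k, by rw [h]; ring⟩
    · rw [quadraticChar_sqrt_five_eq_neg_one_of_dvd hp4 hp5 hc h hb hb5] at hχ
      norm_num at hχ

end SumOfTwoSquares

section SqAddFiveMulSq

theorem exists_eq_sq_add_five_mul_sq (hp4 : p % 4 = 1) (hp5 : p % 5 = 1 ∨ p % 5 = 4) :
    ∃ x y : ℕ, p = x ^ 2 + 5 * y ^ 2 := by
  obtain ⟨c, hc⟩ := exists_sq_eq_five hp5
  obtain ⟨t, ht⟩ := exists_sq_eq_neg_one hp4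
  obtain ⟨s, hs⟩ := ZMod.intCast_surjective (c * t)
  have hdvd : (p : ℤ) ∣ s ^ 2 + (5 : ℕ) := by
    rw [← ZMod.intCast_zmod_eq_zero_iff_dvd]
    push_cast
    rw [hs]
    linear_combination t ^ 2 * hc + 5 * ht
  have hp : ¬IsSquare p := (Fact.out : p.Prime).prime.not_isSquare
  obtain ⟨k, x, y, hk0, hk5, h⟩ := exists_mul_eq_sq_add_mul_sq_of_dvd hp (by norm_num) hdvd
  have hx := sq_mod_five x
  interval_cases k
  · exact ⟨x, y, by rw [← h, one_mul]⟩
  · omega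
  · omega
  · obtain ⟨⟨u, rfl⟩, ⟨v, rfl⟩⟩ := even_and_even_of_four_mul_eq_sq_add_five_mul_sq h
    exact ⟨u, v, by linarith⟩
  · obtain ⟨u, rfl⟩ : 5 ∣ x := Nat.prime_five.dvd_of_dvd_pow (n := 2) (by omega)
    exact ⟨y, u, by linarith⟩

variable {x y : ℕ}

theorem jacobiSym_five_eq_of_eq_sq_add_five_mul_sq {n : ℕ} (hn : n % 5 = 1 ∨ n % 5 = 4)
    (h : n = x ^ 2 + 5 * y ^ 2) : J(x | 5) = quarticSymbolFive n := by
  refine jacobiSym_five_eq_quarticSymbolFive hn (Int.modEq_iff_dvd.mpr ⟨y ^ 2, ?_⟩)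
  rw [h]
  push_cast
  ring

theorem quadraticChar_right_of_even_right (hp4 : p % 4 = 1) (h : p = x ^ 2 + 5 * y ^ 2)
    (hy : Even y) : quadraticChar (ZMod p) y = quadraticChar (ZMod p) 2 := by
  have hy0 : y ≠ 0 := by
    rintro rfl
    exact (Fact.out : p.Prime).prime.not_isSquare ⟨x, by rw [h]; ring⟩
  have h4 (hy4 : 4 ∣ y) : quadraticChar (ZMod p) (2 : ℕ) = 1 := by
    obtain ⟨k, rfl⟩ := hy4
    have hx : Odd x := (odd_left_iff_even_right (Nat.odd_iff.mpr (by omega)) (by decide) h).mpr hy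
    have hx8 := sq_mod_eight_of_odd hx
    rw [Nat.cast_ofNat, quadraticChar_two_of_mod_four hp4, if_pos (by rw [h, mul_pow]; omega)]
  obtain ⟨m, hm, hmy, hχ⟩ := exists_odd_dvd_map_eq_map_two_mul
    (f := fun n : ℕ => quadraticChar (ZMod p) n) (fun a b => by rw [Nat.cast_mul, map_mul])
    hy0 hy h4
  rw [hχ, quadraticChar_eq_one_of_dvd_right hp4 h hm hmy, mul_one, Nat.cast_ofNat]

theorem quadraticChar_left_of_odd_left (hp4 : p % 4 = 1) (hp5 : p % 5 = 1 ∨ p % 5 = 4)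
    (h : p = x ^ 2 + 5 * y ^ 2) (hx : Odd x) :
    quadraticChar (ZMod p) x = quarticSymbolFive p := by
  rw [quadraticChar_eq_jacobiSym_of_dvd_left hp4 h hx dvd_rfl,
    jacobiSym.quadratic_reciprocity_one_mod_four (by norm_num) hx]
  exact jacobiSym_five_eq_of_eq_sq_add_five_mul_sq hp5 h

theorem quadraticChar_mul_jacobiSym_five_of_dvd_left (hp4 : p % 4 = 1) (hp5 : p % 5 ≠ 0)
    (h : p = x ^ 2 + 5 * y ^ 2) {m : ℕ} (hm : Odd m) (hmx : m ∣ x) :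
    quadraticChar (ZMod p) m * J(m | 5) = 1 := by
  have hm5 : m.Coprime 5 := by
    refine (Nat.prime_five.coprime_iff_not_dvd.mpr fun h5 => hp5 ?_).symm
    have : 5 ∣ x ^ 2 := (h5.trans hmx).trans (dvd_pow_self x two_ne_zero)
    omega
  rw [quadraticChar_eq_jacobiSym_of_dvd_left hp4 h hm hmx,
    jacobiSym.quadratic_reciprocity_one_mod_four (by norm_num) hm, ← pow_two]
  exact jacobiSym.sq_one (by exact_mod_cast hm5)

theorem quadraticChar_left_of_even_left (hp4 : p % 4 = 1) (hp5 : p % 5 = 1 ∨ p % 5 = 4)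
    (h : p = x ^ 2 + 5 * y ^ 2) (hx : Even x) :
    quadraticChar (ZMod p) x = -(quadraticChar (ZMod p) 2 * quarticSymbolFive p) := by
  have hx0 : x ≠ 0 := by
    rintro rfl
    omega
  let f : ℕ → ℤ := fun n => quadraticChar (ZMod p) n * J(n | 5)
  have hf (a b : ℕ) : f (a * b) = f a * f b := by
    simp only [f, Nat.cast_mul, map_mul, jacobiSym.mul_left]
    ring
  have hf2 : f 2 = -quadraticChar (ZMod p) 2 := by
    have hJ2 : J(2 | 5) = -1 := by norm_num
    simp only [f, Nat.cast_ofNat, hJ2, mul_neg, mul_one]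
  have hf4 (hx4 : 4 ∣ x) : f 2 = 1 := by
    obtain ⟨k, rfl⟩ := hx4
    have hy : Odd y := (odd_right_iff_even_left (Nat.odd_iff.mpr (by omega)) (by decide) h).mpr hx
    have hy8 := sq_mod_eight_of_odd hy
    rw [hf2, quadraticChar_two_of_mod_four hp4, if_neg (by rw [h, mul_pow]; omega), neg_neg]
  obtain ⟨m, hm, hmx, hfx⟩ := exists_odd_dvd_map_eq_map_two_mul hf hx0 hx hf4
  have hfm : f m = 1 := quadraticChar_mul_jacobiSym_five_of_dvd_left hp4 (by omega) h hm hmx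
  have hχx : quadraticChar (ZMod p) x * quarticSymbolFive p = -quadraticChar (ZMod p) 2 := by
    rw [← jacobiSym_five_eq_of_eq_sq_add_five_mul_sq hp5 h, ← hf2, ← mul_one (f 2), ← hfm, ← hfx]
  linear_combination quarticSymbolFive p * hχx -
    quadraticChar (ZMod p) x * quarticSymbolFive_mul_self p

theorem quadraticChar_left_eq_mul_right (hp4 : p % 4 = 1) {c : ZMod p} (hc : c ^ 2 = 5)
    (h : p = x ^ 2 + 5 * y ^ 2) : quadraticChar (ZMod p) x =
      quadraticChar (ZMod p) 2 * quadraticChar (ZMod p) c * quadraticChar (ZMod p) y := by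
  obtain ⟨t, ht⟩ := exists_sq_eq_neg_one hp4
  refine quadraticChar_eq_of_sq_add_mul_sq_eq_zero (two_ne_zero_of_mod_four hp4) ht ?_
  rw [hc, ← natCast_sq_add_mul_sq_eq_zero h, Nat.cast_ofNat]

theorem quadraticChar_sqrt_five_of_even_right (hp4 : p % 4 = 1)
    (hp5 : p % 5 = 1 ∨ p % 5 = 4) {c : ZMod p} (hc : c ^ 2 = 5) (h : p = x ^ 2 + 5 * y ^ 2)
    (hy : Even y) : quadraticChar (ZMod p) c = quarticSymbolFive p := by
  have hx : Odd x := (odd_left_iff_even_right (Nat.odd_iff.mpr (by omega)) (by decide) h).mpr hy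
  have hχ := quadraticChar_left_eq_mul_right hp4 hc h
  rw [quadraticChar_left_of_odd_left hp4 hp5 h hx, quadraticChar_right_of_even_right hp4 h hy] at hχ
  have hχ2 := quadraticChar_sq_one (two_ne_zero_of_mod_four hp4)
  linear_combination -hχ - quadraticChar (ZMod p) c * hχ2

theorem quadraticChar_sqrt_five_of_odd_right (hp4 : p % 4 = 1)
    (hp5 : p % 5 = 1 ∨ p % 5 = 4) {c : ZMod p} (hc : c ^ 2 = 5) (h : p = x ^ 2 + 5 * y ^ 2)
    (hy : Odd y) : quadraticChar (ZMod p) c = -quarticSymbolFive p := by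
  have hx : Even x := (odd_right_iff_even_left (Nat.odd_iff.mpr (by omega)) (by decide) h).mp hy
  have hχ := quadraticChar_left_eq_mul_right hp4 hc h
  rw [quadraticChar_left_of_even_left hp4 hp5 h hx,
    quadraticChar_eq_one_of_dvd_right hp4 h hy dvd_rfl] at hχ
  have hχ2 := quadraticChar_sq_one (two_ne_zero_of_mod_four hp4)
  linear_combination -quadraticChar (ZMod p) 2 * hχ -
    (quadraticChar (ZMod p) c + quarticSymbolFive p) * hχ2

theorem exists_eq_sq_add_twenty_mul_sq_iff (hp4 : p % 4 = 1) (hp5 : p % 5 = 1 ∨ p % 5 = 4) :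
    (∃ x y : ℕ, p = x ^ 2 + 20 * y ^ 2) ↔ ((∃ u : ZMod p, u ^ 4 = 5) ↔ p % 5 = 1) := by
  obtain ⟨c, hc⟩ := exists_sq_eq_five hp5
  rw [← quadraticChar_sqrt_five_eq_one_iff hp4 (by omega) hc, ← quarticSymbolFive_eq_one_iff]
  constructor
  · rintro ⟨x, y, h⟩
    have h' : p = x ^ 2 + 5 * (2 * y) ^ 2 := by rw [h]; ring
    rw [quadraticChar_sqrt_five_of_even_right hp4 hp5 hc h' (even_two_mul y)]
  · intro hχ
    obtain ⟨x, y, h⟩ := exists_eq_sq_add_five_mul_sq hp4 hp5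
    rcases Nat.even_or_odd y with hy | hy
    · obtain ⟨k, rfl⟩ := hy.two_dvd
      exact ⟨x, k, by rw [h]; ring⟩
    · rw [quadraticChar_sqrt_five_of_odd_right hp4 hp5 hc h hy, quarticSymbolFive] at hχ
      split_ifs at hχ <;> norm_num at hχ

end SqAddFiveMulSq

end ZModPrime

theorem mainTheorem8 (p : ℕ) (hp : Nat.Prime p) :
    (p ≡ 1 [MOD 20] →
      ((∃ x y : ℤ, (p : ℤ) = x ^ 2 + 20 * y ^ 2) ↔
        (∃ x y : ℤ, (p : ℤ) = x ^ 2 + 100 * y ^ 2))) ∧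
    (p ≡ 9 [MOD 20] →
      Xor (∃ x y : ℤ, (p : ℤ) = x ^ 2 + 20 * y ^ 2)
        (∃ x y : ℤ, (p : ℤ) = x ^ 2 + 100 * y ^ 2)) := by
  have : Fact p.Prime := ⟨hp⟩
  have h20 := exists_int_eq_sq_add_mul_sq_iff (n := p) (d := 20)
  have h100 := exists_int_eq_sq_add_mul_sq_iff (n := p) (d := 100)
  push_cast at h20 h100
  rw [h20, h100]
  constructor <;> intro h <;> rw [Nat.ModEq] at h <;>
    rw [exists_eq_sq_add_twenty_mul_sq_iff (by omega) (by omega),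
      exists_eq_sq_add_hundred_mul_sq_iff (by omega) (by omega)]
  · rw [iff_true_right (show p % 5 = 1 by omega)]
  · rw [iff_false_right (show ¬p % 5 = 1 by omega), xor_not_left]
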